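/- Let $a>0$, $\tau\ge 6$, let $m\ge 10$ be an integer, $k^*=\frac{\pi}{30a}$, and let $$\mathbb{K}=\Big\{\tfrac{\pi}{a}x : x\in\mathbb{R},\ x\ge 1\Big\}\cup\{k^*\}$$ be the admissible set of wavenumbers. For $k\in\mathbb{K}$ put $\lambda_1=\frac12$ and $$R=\tau a,\quad \lambda_2=\tfrac12+\tfrac{\pi}{2kR}\quad\text{if } k\neq k^*,\qquad\qquad R=6a,\quad \lambda_2=-\tfrac32\quad\text{if } k=k^*.$$ With $\nu_\mu=\mu\pi/m$ and for $j=1,\dots,m$, $\ell=1,2$, let $$\partial B_j=\{R(\cos\theta,\sin\theta):\nu_{2j-2}\le\theta\le\nu_{2j}\},\qquad z_{j,\ell}=\lambda_\ell R(\cos\nu_{2j-1},\sin\nu_{2j-1}),$$ and, for $x\in\partial B_j$, $s_\ell=k\,|x-z_{j,\ell}|$. Let $J_0,Y_0$ be the Bessel functions of order zero of the first and second kind, and $$A_{j,k}(x)=\begin{pmatrix}Y_0(s_1)&-J_0(s_1)\\ Y_0(s_2)&-J_0(s_2)\end{pmatrix},$$ $$D_{j,k}(x)=\begin{pmatrix}Y_0(s_1)^2&J_0(s_1)^2&-2Y_0(s_1)J_0(s_1)\\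 Y_0(s_2)^2&J_0(s_2)^2&-2Y_0(s_2)J_0(s_2)\\ Y_0(s_1)Y_0(s_2)&J_0(s_1)J_0(s_2)&-Y_0(s_1)J_0(s_2)-Y_0(s_2)J_0(s_1)\end{pmatrix}.$$ Put $M=\frac{20\tau-7}{20\tau}$ and $M^*=\frac49$. Then for all $k\in\mathbb{K}$, all $j=1,\dots,m$ and all $x\in\partial B_j$: 1. $|\det A_{j,k}(x)|\ge \dfrac{M}{kR}$ if $k\ne k^*$, and $|\det A_{j,k}(x)|\ge M^*$ if $k=k^*$; 2. $\det D_{j,k}(x)=(\det A_{j,k}(x))^3$; 3. $|\det D_{j,k}(x)|\ge \Big(\dfrac{M}{kR}\Big)^3$ if $k\ne k^*$, and $|\det D_{j,k}(x)|\ge (M^*)^3$ if $k=k^*$; 4. both retrieval systems are uniquely solvable: for every $f\in\mathbb{R}^2$ there is exactly one $e\in\mathbb{R}^2$ with $A_{j,k}(x)e=f$, and for every $F\in\mathbb{R}^3$ there is exactly one $v\in\mathbb{R}^3$ with $D_{j,k}(x)v=F$. -/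

import Mathlib

open Real

noncomputable section

namespace PhaseRetrieval

/-- The Bessel function of the first kind of order zero, by its power series. -/
def besselJ0 (t : ℝ) : ℝ :=
  ∑' p : ℕ, (-1 : ℝ) ^ p / (p.factorial : ℝ) ^ 2 * (t / 2) ^ (2 * p)

/-- The Bessel function of the second kind of order zero on the positive reals, by its classical
series (the term `p = 0` of the second sum vanishes, as `harmonic 0 = 0`). -/
def besselY0 (t : ℝ) : ℝ :=
  2 / π * besselJ0 t * (Real.log (t / 2) + Real.eulerMascheroniConstant)
    - 2 / π * ∑' p : ℕ,
        (-1 : ℝ) ^ p * (harmonic p : ℝ) / (p.factorial : ℝ) ^ 2 * (t / 2) ^ (2 * p)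

/-- The small wavenumber `k* = π / (30 a)`. -/
def kStar (a : ℝ) : ℝ := π / (30 * a)

/-- The admissible set of wavenumbers `{(π / a) x : x ≥ 1} ∪ {k*}`. -/
def admissible (a : ℝ) : Set ℝ :=
  {k | ∃ x : ℝ, 1 ≤ x ∧ k = π / a * x} ∪ {kStar a}

/-- The measurement radius: `R = τ a` if `k ≠ k*`, and `R = 6 a` if `k = k*`. -/
def radius (a τ k : ℝ) : ℝ := if k = kStar a then 6 * a else τ * a

/-- The scaling parameters `λ₁`, `λ₂` of the two reference points (indices `0`, `1`); they are the
same in every sector. -/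
def lam (a τ k : ℝ) : Fin 2 → ℝ :=
  ![1 / 2, if k = kStar a then -(3 / 2) else 1 / 2 + π / (2 * k * radius a τ k)]

/-- The angle `ν_μ = μ π / m`. -/
def nu (m : ℕ) (μ : ℝ) : ℝ := μ * π / m

/-- The point of the plane with polar coordinates `(r, θ)` (any real `r`). -/
def polarPt (r θ : ℝ) : EuclideanSpace ℝ (Fin 2) := !₂[r * Real.cos θ, r * Real.sin θ]

/-- The arc `∂B_j` of the circle of radius `R`. -/
def arc (R : ℝ) (m j : ℕ) : Set (EuclideanSpace ℝ (Fin 2)) :=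
  {x | ∃ θ : ℝ, nu m (2 * (j : ℝ) - 2) ≤ θ ∧ θ ≤ nu m (2 * (j : ℝ)) ∧ x = polarPt R θ}

/-- The reference point `z_{j,ℓ} = λ_ℓ R (cos ν_{2j-1}, sin ν_{2j-1})`. -/
def refPt (a τ k : ℝ) (m j : ℕ) (l : Fin 2) : EuclideanSpace ℝ (Fin 2) :=
  polarPt (lam a τ k l * radius a τ k) (nu m (2 * (j : ℝ) - 1))

/-- The argument `k r_{j,ℓ} = k |x - z_{j,ℓ}|` of the Bessel functions. -/
def arg (a τ k : ℝ) (m j : ℕ) (x : EuclideanSpace ℝ (Fin 2)) (l : Fin 2) : ℝ :=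
  k * dist x (refPt a τ k m j l)

/-- The coefficient matrix `A_{j,k}` of the retrieval system for the expectation, at `x`; the
unknowns are `E(Re u)`, `E(Im u)`. -/
def matA (a τ k : ℝ) (m j : ℕ) (x : EuclideanSpace ℝ (Fin 2)) : Matrix (Fin 2) (Fin 2) ℝ :=
  let s := arg a τ k m j x
  !![besselY0 (s 0), -besselJ0 (s 0);
     besselY0 (s 1), -besselJ0 (s 1)]

/-- The coefficient matrix `D_{j,k}` of the retrieval system for the variance, at `x`; the
unknowns are `Var(Re u)`, `Var(Im u)`, `Cov(Re u, Im u)`. -/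
def matD (a τ k : ℝ) (m j : ℕ) (x : EuclideanSpace ℝ (Fin 2)) : Matrix (Fin 3) (Fin 3) ℝ :=
  let s := arg a τ k m j x
  !![besselY0 (s 0) ^ 2, besselJ0 (s 0) ^ 2, -2 * besselY0 (s 0) * besselJ0 (s 0);
     besselY0 (s 1) ^ 2, besselJ0 (s 1) ^ 2, -2 * besselY0 (s 1) * besselJ0 (s 1);
     besselY0 (s 0) * besselY0 (s 1), besselJ0 (s 0) * besselJ0 (s 1),
       -besselY0 (s 0) * besselJ0 (s 1) - besselY0 (s 1) * besselJ0 (s 0)]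

end PhaseRetrieval

end

/-!
The determinant of `A` is the cross product `W(s₂) = J₀(s₁) Y₀(s₂) - J₀(s₂) Y₀(s₁)`, and that of `D`
is its cube, so everything rests on a lower bound for `|W(s₂)|`.

As a function of its second argument, `W` solves Bessel's equation with `W(s₁) = 0` and
`W'(s₁) = 2 / (π s₁)`, the latter by the Wronskian of `J₀` and `Y₀`
(`besselJ0_besselY0_wronskian`). Both facts are derived from the defining power series, which in
the variable `z = (t / 2) ^ 2` have coefficients dominated by those of the exponential series.

If `k ≠ k*`, the scaled radius `K = k R` is at least `6 π`. Then `U = √r W` solves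
`U'' = -(1 + 1 / (4 r²)) U`, a small perturbation of the harmonic oscillator on the interval
`[s₂, s₁]`, whence `|W(s₂)|` is nearly `2 / (π √(s₁ s₂)) sin (s₁ - s₂)`
(`abs_ge_of_perturbed_harmonic`, `abs_besselCross_ge_of_large`). The reference points are chosen
`π / (2 k)` apart, and as seen from the centre the point lies at an angle of at most `π / 10` to
their axis. Hence `s₁ - s₂` is at most `π / 2` and not much smaller, while `s₁` is little more than
`K / 2`; this gives the bound `1 / K` (`abs_besselCross_ge_of_far`), which is stronger than the
claim.

If `k = k*`, both arguments are below `1.6`. In `W` the Euler–Mascheroni constants cancel, leaving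
`(2 / π) (J₀(s₁) J₀(s₂) log (s₂ / s₁) - J₀(s₁) S(s₂) + J₀(s₂) S(s₁))` with `S` the entire part of
`Y₀`, and the first terms of the alternating series of `J₀` and `S` suffice
(`besselCross_ge_of_small`).
-/

namespace PhaseRetrieval

/-! ### Power series dominated by the exponential series -/

/-- The value at `z` of the power series with real coefficients `c`. -/
noncomputable def powSum (c : ℕ → ℝ) (z : ℝ) : ℝ := ∑' p : ℕ, c p * z ^ p

/-- The coefficients of the termwise derivative of the power series with coefficients `c`. -/
def derivCoeff (c : ℕ → ℝ) (p : ℕ) : ℝ := (p + 1) * c (p + 1)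

lemma hasSum_powSum {c : ℕ → ℝ} (hc : ∀ p, |c p| ≤ 1 / (p.factorial : ℝ)) (z : ℝ) :
    HasSum (fun p => c p * z ^ p) (powSum c z) := by
  refine Summable.hasSum (Summable.of_norm_bounded (Real.summable_pow_div_factorial |z|) fun p => ?_)
  rw [norm_mul, norm_pow, Real.norm_eq_abs, Real.norm_eq_abs]
  calc |c p| * |z| ^ p ≤ 1 / (p.factorial : ℝ) * |z| ^ p := by gcongr; exact hc p
    _ = |z| ^ p / (p.factorial : ℝ) := by ring

lemma abs_derivCoeff_le {c : ℕ → ℝ} (hc : ∀ p, |c p| ≤ 1 / (p.factorial : ℝ)) (p : ℕ) :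
    |derivCoeff c p| ≤ 1 / (p.factorial : ℝ) := by
  have h := hc (p + 1)
  have hp : (0 : ℝ) < p + 1 := by positivity
  rw [Nat.factorial_succ, Nat.cast_mul, Nat.cast_add, Nat.cast_one] at h
  rw [derivCoeff, abs_mul, abs_of_pos hp]
  calc ((p : ℝ) + 1) * |c (p + 1)| ≤ (p + 1) * (1 / ((p + 1) * (p.factorial : ℝ))) := by gcongr
    _ = 1 / (p.factorial : ℝ) := by field_simp

/-- Power series whose coefficients are dominated by those of the exponential are differentiable
termwise. By `abs_derivCoeff_le` the bound is inherited by the derived series, so the lemma can be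
iterated. -/
lemma hasDerivAt_powSum {c : ℕ → ℝ} (hc : ∀ p, |c p| ≤ 1 / (p.factorial : ℝ)) (z : ℝ) :
    HasDerivAt (powSum c) (powSum (derivCoeff c) z) z := by
  set r : ℝ := |z| + 1
  have hr : 0 < r := by positivity
  -- the termwise derivatives are dominated on the ball of radius `r` by a shifted exponential series
  have hu : Summable fun p : ℕ => (p : ℝ) / (p.factorial : ℝ) * r ^ (p - 1) := by
    rw [← summable_nat_add_iff 1]
    refine (Real.summable_pow_div_factorial r).congr fun p => ?_
    rw [Nat.factorial_succ]
    push_cast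
    field_simp
  have key := hasDerivAt_tsum_of_isPreconnected (g := fun p y => c p * y ^ p)
    (g' := fun p y => c p * (p * y ^ (p - 1))) (t := Metric.ball 0 r) (y₀ := 0) (y := z) hu
    Metric.isOpen_ball (convex_ball _ _).isPreconnected
    (fun p y _ => (hasDerivAt_pow p y).const_mul _)
    (fun p y hy => by
      rw [mem_ball_zero_iff, Real.norm_eq_abs] at hy
      rw [norm_mul, norm_mul, norm_pow, Real.norm_eq_abs, Real.norm_eq_abs, Real.norm_eq_abs,
        Nat.abs_cast]
      calc |c p| * (p * |y| ^ (p - 1)) ≤ 1 / (p.factorial : ℝ) * (p * r ^ (p - 1)) := by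
            gcongr
            exact hc p
        _ = _ := by ring)
    (Metric.mem_ball_self hr) (hasSum_powSum hc 0).summable
    (by rw [mem_ball_zero_iff, Real.norm_eq_abs]; exact lt_add_one _)
  have hs : Summable fun p : ℕ => c p * (p * z ^ (p - 1)) := by
    rw [← summable_nat_add_iff 1]
    refine (hasSum_powSum (abs_derivCoeff_le hc) z).summable.congr fun p => ?_
    simp only [derivCoeff, Nat.add_sub_cancel]
    push_cast
    ring
  have e : powSum (derivCoeff c) z = ∑' p : ℕ, c p * (p * z ^ (p - 1)) := by
    rw [hs.tsum_eq_zero_add, powSum]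
    simp only [derivCoeff, Nat.add_sub_cancel, Nat.cast_zero, zero_mul, mul_zero, zero_add]
    push_cast
    exact tsum_congr fun p => by ring
  rw [e]
  exact key

/-- The power series of `z f'' + f'`, for `f` the power series with coefficients `c`; this is the
Bessel operator of order zero in the variable `z = (t / 2) ^ 2`. -/
lemma mul_powSum_derivCoeff_add {c : ℕ → ℝ} (hc : ∀ p, |c p| ≤ 1 / (p.factorial : ℝ)) (z : ℝ) :
    HasSum (fun p : ℕ => ((p : ℝ) + 1) ^ 2 * c (p + 1) * z ^ p)
      (z * powSum (derivCoeff (derivCoeff c)) z + powSum (derivCoeff c) z) := by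
  have h1 := hasSum_powSum (abs_derivCoeff_le hc) z
  have h2 := (hasSum_powSum (abs_derivCoeff_le (abs_derivCoeff_le hc)) z).mul_left z
  have h3 : HasSum (fun p : ℕ => (p : ℝ) * derivCoeff c p * z ^ p)
      (z * powSum (derivCoeff (derivCoeff c)) z) := by
    rw [← hasSum_nat_add_iff' 1]
    simp only [Finset.sum_range_one, Nat.cast_zero, zero_mul, sub_zero]
    refine h2.congr_fun fun p => ?_
    simp only [derivCoeff]
    push_cast
    ring
  refine (h3.add h1).congr_fun fun p => ?_
  simp only [derivCoeff]
  ring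

/-! ### The series of `J₀` and of the entire part of `Y₀` -/

/-- The coefficients of `J₀` as a power series in `z = (t / 2) ^ 2`. -/
noncomputable def coeffJ (p : ℕ) : ℝ := (-1) ^ p / (p.factorial : ℝ) ^ 2

/-- The coefficients, in `z = (t / 2) ^ 2`, of the non-logarithmic series in the definition of
`Y₀`. -/
noncomputable def coeffS (p : ℕ) : ℝ := (-1) ^ p * (harmonic p : ℝ) / (p.factorial : ℝ) ^ 2

lemma abs_coeffJ_le (p : ℕ) : |coeffJ p| ≤ 1 / (p.factorial : ℝ) := by
  have h : (1 : ℝ) ≤ p.factorial := by exact_mod_cast p.factorial_pos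
  rw [coeffJ, abs_div, abs_pow, abs_neg, abs_one, one_pow, abs_of_pos (by positivity)]
  gcongr
  nlinarith

lemma harmonic_nonneg (p : ℕ) : (0 : ℝ) ≤ harmonic p := by
  rw [harmonic]
  push_cast
  positivity

lemma harmonic_le_factorial (p : ℕ) : (harmonic p : ℝ) ≤ p.factorial := by
  have h : (harmonic p : ℝ) ≤ p := by
    induction p with
    | zero => simp
    | succ n ih =>
      rw [harmonic_succ]
      push_cast
      have : ((n : ℝ) + 1)⁻¹ ≤ 1 := inv_le_one_of_one_le₀ (by linarith [n.cast_nonneg (α := ℝ)])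
      linarith
  exact h.trans (by exact_mod_cast p.self_le_factorial)

lemma abs_coeffS_le (p : ℕ) : |coeffS p| ≤ 1 / (p.factorial : ℝ) := by
  have h : (0 : ℝ) < p.factorial := by exact_mod_cast p.factorial_pos
  rw [coeffS, abs_div, abs_mul, abs_pow, abs_neg, abs_one, one_pow, one_mul,
    abs_of_nonneg (harmonic_nonneg p), abs_of_pos (by positivity), div_le_div_iff₀ (by positivity) h]
  nlinarith [harmonic_le_factorial p]

lemma powSum_coeffJ_ode (z : ℝ) :
    z * powSum (derivCoeff (derivCoeff coeffJ)) z + powSum (derivCoeff coeffJ) z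
      = -powSum coeffJ z := by
  refine (mul_powSum_derivCoeff_add abs_coeffJ_le z).unique
    ((hasSum_powSum abs_coeffJ_le z).neg.congr_fun fun p => ?_)
  simp only [coeffJ, Nat.factorial_succ]
  push_cast
  field_simp
  ring

lemma powSum_coeffS_ode (z : ℝ) :
    z * powSum (derivCoeff (derivCoeff coeffS)) z + powSum (derivCoeff coeffS) z
      = powSum (derivCoeff coeffJ) z - powSum coeffS z := by
  refine (mul_powSum_derivCoeff_add abs_coeffS_le z).unique
    (((hasSum_powSum (abs_derivCoeff_le abs_coeffJ_le) z).sub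
      (hasSum_powSum abs_coeffS_le z)).congr_fun fun p => ?_)
  simp only [derivCoeff, coeffJ, coeffS, Nat.factorial_succ, harmonic_succ]
  push_cast
  field_simp
  ring

/-- The Wronskian of `J₀` and `Y₀` in disguise: free of the logarithm, the left side is entire, so
that its constant value is read off at `z = 0`. -/
lemma powSum_wronskian (z : ℝ) :
    powSum coeffJ z ^ 2 - 2 * z * (powSum coeffJ z * powSum (derivCoeff coeffS) z
      - powSum (derivCoeff coeffJ) z * powSum coeffS z) = 1 := by
  set K : ℝ → ℝ := fun z => powSum coeffJ z ^ 2 - 2 * z * (powSum coeffJ z *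
    powSum (derivCoeff coeffS) z - powSum (derivCoeff coeffJ) z * powSum coeffS z) with hK
  have hd : ∀ w, HasDerivAt K 0 w := fun w => by
    have j0 := hasDerivAt_powSum abs_coeffJ_le w
    have j1 := hasDerivAt_powSum (abs_derivCoeff_le abs_coeffJ_le) w
    have s0 := hasDerivAt_powSum abs_coeffS_le w
    have s1 := hasDerivAt_powSum (abs_derivCoeff_le abs_coeffS_le) w
    refine ((j0.pow 2).sub (((hasDerivAt_id w).const_mul 2).mul
      ((j0.mul s1).sub (j1.mul s0)))).congr_deriv ?_
    have e1 := powSum_coeffJ_ode w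
    have e2 := powSum_coeffS_ode w
    simp only [id, Pi.mul_apply, Pi.sub_apply]
    push_cast
    linear_combination 2 * powSum coeffS w * e1 - 2 * powSum coeffJ w * e2
  have hc : K z = K 0 :=
    is_const_of_deriv_eq_zero (fun w => (hd w).differentiableAt) (fun w => (hd w).deriv) z 0
  have h0 : powSum coeffJ 0 = 1 := by
    rw [powSum, tsum_eq_single 0 fun p hp => by simp [hp]]
    simp [coeffJ]
  change K z = 1
  rw [hc, hK]
  simp [h0]

/-! ### Bessel's equation and the Wronskian of `J₀` and `Y₀` -/

/-- The entire part of `Y₀`: up to the factor `-2 / π`, what is left of `Y₀` when its logarithmic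
term is removed. -/
noncomputable def serS (t : ℝ) : ℝ := powSum coeffS ((t / 2) ^ 2)

lemma besselJ0_eq (t : ℝ) : besselJ0 t = powSum coeffJ ((t / 2) ^ 2) := by
  simp only [besselJ0, powSum, coeffJ, pow_mul]

lemma besselY0_eq (t : ℝ) : besselY0 t =
    2 / π * (besselJ0 t * (Real.log (t / 2) + Real.eulerMascheroniConstant) - serS t) := by
  simp only [besselY0, serS, powSum, coeffS, pow_mul]
  ring

/-- The derivative of `besselJ0`. -/
noncomputable def besselJ0' (t : ℝ) : ℝ := t / 2 * powSum (derivCoeff coeffJ) ((t / 2) ^ 2)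

/-- The derivative of `serS`. -/
noncomputable def serS' (t : ℝ) : ℝ := t / 2 * powSum (derivCoeff coeffS) ((t / 2) ^ 2)

/-- The derivative of `besselY0` on the positive reals. -/
noncomputable def besselY0' (t : ℝ) : ℝ :=
  2 / π * (besselJ0' t * (Real.log (t / 2) + Real.eulerMascheroniConstant)
    + besselJ0 t / t - serS' t)

lemma hasDerivAt_half_sq (t : ℝ) : HasDerivAt (fun t : ℝ => (t / 2) ^ 2) (t / 2) t := by
  refine (((hasDerivAt_id t).div_const 2).pow 2).congr_deriv ?_
  simp only [id]
  push_cast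
  ring

lemma hasDerivAt_comp_half_sq {c : ℕ → ℝ} (hc : ∀ p, |c p| ≤ 1 / (p.factorial : ℝ)) (t : ℝ) :
    HasDerivAt (fun t => powSum c ((t / 2) ^ 2))
      (t / 2 * powSum (derivCoeff c) ((t / 2) ^ 2)) t :=
  ((hasDerivAt_powSum hc _).comp t (hasDerivAt_half_sq t)).congr_deriv (mul_comm _ _)

lemma hasDerivAt_half_mul_comp {c : ℕ → ℝ} (hc : ∀ p, |c p| ≤ 1 / (p.factorial : ℝ)) (t : ℝ) :
    HasDerivAt (fun t => t / 2 * powSum (derivCoeff c) ((t / 2) ^ 2))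
      (powSum (derivCoeff c) ((t / 2) ^ 2) / 2
        + (t / 2) ^ 2 * powSum (derivCoeff (derivCoeff c)) ((t / 2) ^ 2)) t := by
  refine (((hasDerivAt_id t).div_const 2).mul
    (hasDerivAt_comp_half_sq (abs_derivCoeff_le hc) t)).congr_deriv ?_
  simp only [id]
  ring

lemma hasDerivAt_besselJ0 (t : ℝ) : HasDerivAt besselJ0 (besselJ0' t) t := by
  rw [funext besselJ0_eq]
  exact hasDerivAt_comp_half_sq abs_coeffJ_le t

lemma hasDerivAt_besselJ0' {t : ℝ} (ht : 0 < t) :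
    HasDerivAt besselJ0' (-besselJ0' t / t - besselJ0 t) t := by
  refine (hasDerivAt_half_mul_comp abs_coeffJ_le t).congr_deriv ?_
  rw [besselJ0', besselJ0_eq]
  have := powSum_coeffJ_ode ((t / 2) ^ 2)
  have e : -(t / 2 * powSum (derivCoeff coeffJ) ((t / 2) ^ 2)) / t
    = -powSum (derivCoeff coeffJ) ((t / 2) ^ 2) / 2 := by field_simp
  rw [e]
  linear_combination this

lemma hasDerivAt_serS (t : ℝ) : HasDerivAt serS (serS' t) t :=
  hasDerivAt_comp_half_sq abs_coeffS_le t

lemma hasDerivAt_serS' {t : ℝ} (ht : 0 < t) :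
    HasDerivAt serS' (-serS' t / t - serS t + 2 * besselJ0' t / t) t := by
  refine (hasDerivAt_half_mul_comp abs_coeffS_le t).congr_deriv ?_
  rw [besselJ0', serS', serS]
  have := powSum_coeffS_ode ((t / 2) ^ 2)
  have e : -(t / 2 * powSum (derivCoeff coeffS) ((t / 2) ^ 2)) / t
    = -powSum (derivCoeff coeffS) ((t / 2) ^ 2) / 2 := by field_simp
  have e' : 2 * (t / 2 * powSum (derivCoeff coeffJ) ((t / 2) ^ 2)) / t
    = powSum (derivCoeff coeffJ) ((t / 2) ^ 2) := by field_simp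
  rw [e, e']
  linear_combination this

lemma hasDerivAt_log_half {t : ℝ} (ht : 0 < t) :
    HasDerivAt (fun t => Real.log (t / 2) + Real.eulerMascheroniConstant) (1 / t) t := by
  refine ((((hasDerivAt_id t).div_const 2).log (by simp [ht.ne'])).add_const _).congr_deriv ?_
  simp only [id]
  field_simp

lemma hasDerivAt_besselY0 {t : ℝ} (ht : 0 < t) : HasDerivAt besselY0 (besselY0' t) t := by
  rw [funext besselY0_eq]
  refine ((((hasDerivAt_besselJ0 t).mul (hasDerivAt_log_half ht)).sub
    (hasDerivAt_serS t)).const_mul (2 / π)).congr_deriv ?_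
  rw [besselY0']
  ring

lemma hasDerivAt_besselY0' {t : ℝ} (ht : 0 < t) :
    HasDerivAt besselY0' (-besselY0' t / t - besselY0 t) t := by
  refine (((((hasDerivAt_besselJ0' ht).mul (hasDerivAt_log_half ht)).add
    ((hasDerivAt_besselJ0 t).div (hasDerivAt_id t) ht.ne')).sub
    (hasDerivAt_serS' ht)).const_mul (2 / π)).congr_deriv ?_
  rw [besselY0', besselY0_eq]
  simp only [id]
  field_simp
  ring

lemma besselJ0_besselY0_wronskian {t : ℝ} (ht : 0 < t) :
    besselJ0 t * besselY0' t - besselJ0' t * besselY0 t = 2 / (π * t) := by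
  have h := powSum_wronskian ((t / 2) ^ 2)
  have e : besselJ0 t * besselY0' t - besselJ0' t * besselY0 t = 2 / (π * t) *
      (besselJ0 t ^ 2 - t * (besselJ0 t * serS' t - besselJ0' t * serS t)) := by
    rw [besselY0', besselY0_eq]
    field_simp
    ring
  rw [e, besselJ0_eq, besselJ0', serS', serS]
  linear_combination 2 / (π * t) * h

/-! ### The cross product of `J₀` and `Y₀` -/

/-- The cross product `J₀(s) Y₀(t) - J₀(t) Y₀(s)`; in `t` it is the solution of Bessel's equation
that vanishes at `s` with slope `2 / (π s)`. -/
noncomputable def besselCross (s t : ℝ) : ℝ := besselJ0 s * besselY0 t - besselJ0 t * besselY0 s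

/-- The derivative of `besselCross s t` in `t`. -/
noncomputable def besselCross' (s t : ℝ) : ℝ :=
  besselJ0 s * besselY0' t - besselJ0' t * besselY0 s

lemma hasDerivAt_besselCross (s : ℝ) {t : ℝ} (ht : 0 < t) :
    HasDerivAt (besselCross s) (besselCross' s t) t :=
  ((hasDerivAt_besselY0 ht).const_mul _).sub ((hasDerivAt_besselJ0 t).mul_const _)

lemma hasDerivAt_besselCross' (s : ℝ) {t : ℝ} (ht : 0 < t) :
    HasDerivAt (besselCross' s) (-besselCross' s t / t - besselCross s t) t := by
  refine (((hasDerivAt_besselY0' ht).const_mul (besselJ0 s)).sub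
    ((hasDerivAt_besselJ0' ht).mul_const (besselY0 s))).congr_deriv ?_
  rw [besselCross, besselCross']
  ring

lemma besselCross_self (s : ℝ) : besselCross s s = 0 := by
  rw [besselCross, sub_self]

lemma besselCross'_self {s : ℝ} (hs : 0 < s) : besselCross' s s = 2 / (π * s) :=
  besselJ0_besselY0_wronskian hs

/-! ### Large arguments: comparison with the sine -/

/-- A solution of `U'' = -(1 + q) U` with `U b = 0` differs at `a` from the solution
`-U'(b) sin (b - ·)` for `q = 0` by at most `|U'(b)| κ / (1 - κ)`, where `κ < 1`
bounds `(b - a) sup |q|`. -/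
lemma abs_ge_of_perturbed_harmonic {U U' q : ℝ → ℝ} {a b ε κ : ℝ} (hab : a ≤ b) (hε : 0 ≤ ε)
    (hκ : ε * (b - a) ≤ κ) (hκ1 : κ < 1)
    (hU : ∀ r ∈ Set.Icc a b, HasDerivAt U (U' r) r)
    (hU' : ∀ r ∈ Set.Icc a b, HasDerivAt U' (-(1 + q r) * U r) r)
    (hq : ∀ r ∈ Set.Icc a b, |q r| ≤ ε) (hb : U b = 0) :
    |U' b| * (sin (b - a) - κ / (1 - κ)) ≤ |U a| := by
  have hcont : ContinuousOn (fun r => |U r|) (Set.Icc a b) :=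
    ContinuousOn.abs fun r hr => (hU r hr).continuousAt.continuousWithinAt
  obtain ⟨s₀, hs₀, hmax⟩ := isCompact_Icc.exists_isMaxOn (Set.nonempty_Icc.2 hab) hcont
  set M := |U s₀| with hM
  have hM0 : 0 ≤ M := abs_nonneg _
  have key : ∀ s ∈ Set.Icc a b, |U s + U' b * sin (b - s)| ≤ κ * M := fun s hs => by
    have hsub : Set.Icc s b ⊆ Set.Icc a b := Set.Icc_subset_Icc_left hs.1
    -- for `q = 0` the function `U' sin (· - s) - U cos (· - s)` is constant
    have hH : ∀ r ∈ Set.Icc s b, HasDerivWithinAt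
        (fun r => U' r * sin (r - s) - U r * cos (r - s)) (-(q r * U r * sin (r - s)))
        (Set.Icc s b) r := fun r hr => by
      have h1 : HasDerivAt (fun r : ℝ => r - s) 1 r := (hasDerivAt_id r).sub_const s
      refine (((hU' r (hsub hr)).mul h1.sin).sub
        ((hU r (hsub hr)).mul h1.cos)).hasDerivWithinAt.congr_deriv ?_
      ring
    have hbd : ∀ r ∈ Set.Icc s b, ‖-(q r * U r * sin (r - s))‖ ≤ ε * M := fun r hr => by
      rw [norm_neg, norm_mul, norm_mul, Real.norm_eq_abs, Real.norm_eq_abs, Real.norm_eq_abs]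
      have h1 : |U r| ≤ M := hmax (hsub hr)
      calc |q r| * |U r| * |sin (r - s)| ≤ ε * M * 1 := by
            gcongr
            · exact hq r (hsub hr)
            · exact abs_sin_le_one _
        _ = ε * M := mul_one _
    have h := (convex_Icc s b).norm_image_sub_le_of_norm_hasDerivWithin_le hH hbd
      (Set.left_mem_Icc.2 hs.2) (Set.right_mem_Icc.2 hs.2)
    simp only [hb, sub_self, sin_zero, cos_zero, Real.norm_eq_abs, zero_mul, mul_zero, mul_one,
      zero_sub, sub_zero, sub_neg_eq_add, abs_of_nonneg (sub_nonneg.2 hs.2)] at h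
    rw [add_comm]
    refine h.trans ?_
    calc ε * M * (b - s) ≤ ε * M * (b - a) := by gcongr; exact hs.1
      _ = ε * (b - a) * M := by ring
      _ ≤ κ * M := by gcongr
  have hMle : M * (1 - κ) ≤ |U' b| := by
    have h1 := key s₀ hs₀
    have h2 : |U s₀| ≤ |U s₀ + U' b * sin (b - s₀)| + |U' b * sin (b - s₀)| := by
      have := abs_sub (U s₀ + U' b * sin (b - s₀)) (U' b * sin (b - s₀))
      rwa [add_sub_cancel_right] at this
    have h3 : |U' b * sin (b - s₀)| ≤ |U' b| := by
      rw [abs_mul]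
      exact mul_le_of_le_one_right (abs_nonneg _) (abs_sin_le_one _)
    linarith
  have hκ0 : 0 ≤ κ := (mul_nonneg hε (sub_nonneg.2 hab)).trans hκ
  have hκM : κ * M ≤ |U' b| * (κ / (1 - κ)) := by
    have : M ≤ |U' b| / (1 - κ) := by rwa [le_div_iff₀ (by linarith)]
    calc κ * M ≤ κ * (|U' b| / (1 - κ)) := by gcongr
      _ = _ := by ring
  have h1 := key a (Set.left_mem_Icc.2 hab)
  have h2 : |U' b * sin (b - a)| ≤ |U a + U' b * sin (b - a)| + |U a| := by
    have := abs_sub (U a + U' b * sin (b - a)) (U a)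
    rwa [add_sub_cancel_left] at this
  have h3 : |U' b| * sin (b - a) ≤ |U' b * sin (b - a)| := by
    rw [abs_mul]
    gcongr
    exact le_abs_self _
  linarith

/-- For large arguments that are almost a quarter period apart, the cross product is close to its
asymptotic value `-2 / (π √(s₁ s₂)) sin (s₁ - s₂)`. -/
lemma abs_besselCross_ge_of_large {s₁ s₂ : ℝ} (h2 : 39 / 5 ≤ s₂) (hd : 117 / 100 ≤ s₁ - s₂)
    (hd' : s₁ - s₂ ≤ π / 2) : 57 / 100 / s₁ ≤ |besselCross s₁ s₂| := by
  have hs1 : 0 < s₁ := by linarith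
  have hs2 : 0 < s₂ := by linarith
  have hπ : π < 3.1416 := pi_lt_d4
  have hsqrt : ∀ r : ℝ, 0 < r → HasDerivAt Real.sqrt (1 / (2 * √r)) r :=
    fun r hr => Real.hasDerivAt_sqrt hr.ne'
  -- the substitution `U = √r W` removes the first-order term of Bessel's equation
  have key := abs_ge_of_perturbed_harmonic (a := s₂) (b := s₁) (ε := 1 / 240) (κ := 7 / 1000)
    (U := fun r => √r * besselCross s₁ r)
    (U' := fun r => 1 / (2 * √r) * besselCross s₁ r + √r * besselCross' s₁ r)
    (q := fun r => 1 / (4 * r ^ 2)) (by linarith) (by norm_num) (by linarith) (by norm_num)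
    (fun r hr => (hsqrt r (hs2.trans_le hr.1)).mul
      (hasDerivAt_besselCross s₁ (hs2.trans_le hr.1)))
    (fun r hr => by
      have hr0 : 0 < r := hs2.trans_le hr.1
      have hq0 : 0 < √r := Real.sqrt_pos.2 hr0
      have hinv : HasDerivAt (fun r => 1 / (2 * √r)) (-(1 / (4 * r * √r))) r := by
        refine (((hsqrt r hr0).const_mul 2).inv (by positivity)).congr_deriv ?_ |>.congr_of_eventuallyEq
          (Filter.Eventually.of_forall fun x => one_div _)
        rw [mul_pow, Real.sq_sqrt hr0.le]
        field_simp
        norm_num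
      refine ((hinv.mul (hasDerivAt_besselCross s₁ hr0)).add
        ((hsqrt r hr0).mul (hasDerivAt_besselCross' s₁ hr0))).congr_deriv ?_
      obtain ⟨w, hw⟩ : ∃ w, w = √r := ⟨_, rfl⟩
      have hw2 : r = w ^ 2 := by rw [hw, Real.sq_sqrt hr0.le]
      have hw0 : 0 < w := hw ▸ hq0
      rw [← hw]
      generalize besselCross s₁ r = W
      generalize besselCross' s₁ r = W'
      subst hw2
      field_simp
      ring)
    (fun r hr => by
      have hr0 : 39 / 5 ≤ r := h2.trans hr.1
      rw [abs_of_pos (by positivity)]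
      exact one_div_le_one_div_of_le (by norm_num) (by nlinarith))
    (by simp only [besselCross_self, mul_zero])
  simp only [besselCross_self, mul_zero, zero_add, besselCross'_self hs1] at key
  have hsin : 919 / 1000 ≤ sin (s₁ - s₂) := by
    rw [← cos_pi_div_two_sub]
    have := one_sub_sq_div_two_le_cos (x := π / 2 - (s₁ - s₂))
    nlinarith
  have hq1 : 0 < √s₁ := Real.sqrt_pos.2 hs1
  have hq2 : 0 < √s₂ := Real.sqrt_pos.2 hs2
  have hq12 : √s₂ ≤ √s₁ := Real.sqrt_le_sqrt (by linarith)
  rw [abs_of_pos (by positivity), abs_mul, abs_of_pos hq2] at key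
  have hπ' : 636 / 1000 ≤ 2 / π := by
    rw [le_div_iff₀ pi_pos]
    linarith
  have h1 : 57 / 100 * (√s₁ / s₁) ≤ √s₁ * (2 / (π * s₁)) *
      (sin (s₁ - s₂) - 7 / 1000 / (1 - 7 / 1000)) := by
    have e : √s₁ * (2 / (π * s₁)) * (sin (s₁ - s₂) - 7 / 1000 / (1 - 7 / 1000))
        = (2 / π * (sin (s₁ - s₂) - 7 / 1000 / (1 - 7 / 1000))) * (√s₁ / s₁) := by
      field_simp
    rw [e]
    gcongr
    have : 911 / 1000 ≤ sin (s₁ - s₂) - 7 / 1000 / (1 - 7 / 1000) := by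
      norm_num at hsin ⊢
      linarith
    nlinarith
  have h3 : √s₁ * (57 / 100 / s₁) ≤ √s₁ * |besselCross s₁ s₂| := by
    calc √s₁ * (57 / 100 / s₁) = 57 / 100 * (√s₁ / s₁) := by ring
      _ ≤ √s₂ * |besselCross s₁ s₂| := h1.trans key
      _ ≤ √s₁ * |besselCross s₁ s₂| := by gcongr
  exact le_of_mul_le_mul_left h3 hq1

/-! ### Small arguments: alternating series -/

/-- In the cross product the Euler–Mascheroni constants cancel. -/
lemma besselCross_eq {s t : ℝ} (hs : 0 < s) (ht : 0 < t) : besselCross s t =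
    2 / π * (besselJ0 s * besselJ0 t * Real.log (t / s)
      - besselJ0 s * serS t + besselJ0 t * serS s) := by
  rw [besselCross, besselY0_eq, besselY0_eq, Real.log_div ht.ne' hs.ne',
    Real.log_div ht.ne' two_ne_zero, Real.log_div hs.ne' two_ne_zero]
  ring

lemma antitone_pow_div_factorial_sq {z : ℝ} (hz : 0 ≤ z) (hz1 : z ≤ 1) :
    Antitone fun p : ℕ => z ^ p / (p.factorial : ℝ) ^ 2 := by
  intro p q hpq
  have : (p.factorial : ℝ) ≤ q.factorial := by exact_mod_cast Nat.factorial_le hpq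
  have hp : (0 : ℝ) < p.factorial := by exact_mod_cast p.factorial_pos
  exact div_le_div₀ (by positivity) (pow_le_pow_of_le_one hz hz1 hpq) (by positivity) (by gcongr)

lemma powSum_coeffJ_bounds {z : ℝ} (hz : 0 ≤ z) (hz1 : z ≤ 1) :
    1 - z ≤ powSum coeffJ z ∧ powSum coeffJ z ≤ 1 := by
  have hs : HasSum (fun p : ℕ => (-1 : ℝ) ^ p * (z ^ p / (p.factorial : ℝ) ^ 2))
      (powSum coeffJ z) :=
    (hasSum_powSum abs_coeffJ_le z).congr_fun fun p => by simp only [coeffJ]; ring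
  have ha := antitone_pow_div_factorial_sq hz hz1
  have h1 := ha.alternating_series_le_tendsto hs.tendsto_sum_nat 1
  have h2 := ha.tendsto_le_alternating_series hs.tendsto_sum_nat 0
  norm_num [Finset.sum_range_succ] at h1 h2
  exact ⟨by linarith, h2⟩

lemma powSum_coeffS_bounds {z : ℝ} (hz : 0 ≤ z) (hz1 : z ≤ 1) :
    -z ≤ powSum coeffS z ∧ powSum coeffS z ≤ -z + 3 / 8 * z ^ 2 := by
  -- the term `p = 0` of the series is zero, so the alternating series starts at `p = 1`
  have hs : HasSum (fun p : ℕ => (-1 : ℝ) ^ p *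
      ((harmonic (p + 1) : ℝ) * z ^ (p + 1) / ((p + 1).factorial : ℝ) ^ 2))
      (-powSum coeffS z) := by
    have h := ((hasSum_nat_add_iff' 1).2 (hasSum_powSum abs_coeffS_le z)).neg
    simp only [Finset.sum_range_one, coeffS, harmonic_zero, Rat.cast_zero, mul_zero, zero_div,
      zero_mul, sub_zero] at h
    exact h.congr_fun fun p => by ring
  have ha : Antitone fun p : ℕ =>
      (harmonic (p + 1) : ℝ) * z ^ (p + 1) / ((p + 1).factorial : ℝ) ^ 2 := by
    refine antitone_nat_of_succ_le fun p => ?_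
    have hH : ((harmonic (p + 2) : ℚ) : ℝ) ≤ 2 * (harmonic (p + 1) : ℝ) := by
      have h1 : (harmonic (p + 1) : ℝ) = harmonic p + ((p : ℝ) + 1)⁻¹ := by
        rw [harmonic_succ]; push_cast; ring
      have h2 : (harmonic (p + 2) : ℝ) = harmonic (p + 1) + ((p : ℝ) + 2)⁻¹ := by
        rw [harmonic_succ (p + 1)]; push_cast; ring
      have h3 : ((p : ℝ) + 2)⁻¹ ≤ ((p : ℝ) + 1)⁻¹ := by gcongr; norm_num
      linarith [harmonic_nonneg p]
    have hf : ((p + 1 + 1).factorial : ℝ) = (p + 2) * ((p + 1).factorial : ℝ) := by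
      rw [Nat.factorial_succ]; push_cast; ring
    have hpos : (0 : ℝ) < (p + 1).factorial := by exact_mod_cast (p + 1).factorial_pos
    have h0 := harmonic_nonneg (p + 1)
    have hz' : z ^ (p + 1 + 1) ≤ z ^ (p + 1) := pow_le_pow_of_le_one hz hz1 (by omega)
    have h4 : (2 : ℝ) ≤ (p + 2) ^ 2 := by nlinarith [p.cast_nonneg (α := ℝ)]
    rw [hf, mul_pow, div_le_div_iff₀ (by positivity) (by positivity)]
    calc (harmonic (p + 1 + 1) : ℝ) * z ^ (p + 1 + 1) * ((p + 1).factorial : ℝ) ^ 2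
        ≤ (2 * (harmonic (p + 1) : ℝ)) * z ^ (p + 1) * ((p + 1).factorial : ℝ) ^ 2 := by
          gcongr
      _ = (harmonic (p + 1) : ℝ) * z ^ (p + 1) * (2 * ((p + 1).factorial : ℝ) ^ 2) := by ring
      _ ≤ _ := by gcongr
  have h1 := ha.alternating_series_le_tendsto hs.tendsto_sum_nat 1
  have h2 := ha.tendsto_le_alternating_series hs.tendsto_sum_nat 0
  norm_num [Finset.sum_range_succ, harmonic_succ, Nat.factorial] at h1 h2
  exact ⟨by linarith, by linarith⟩

/-- For the small wavenumber the terms of `besselCross_eq` are bounded one by one: the logarithm by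
`1`, the series by their first terms. -/
lemma besselCross_ge_of_small {s₁ s₂ : ℝ} (h1 : 0 < s₁) (h1' : s₁ ^ 2 ≤ 12 / 100) (h2 : 0 < s₂)
    (h2' : 12 / 5 ≤ s₂ ^ 2) (h2'' : s₂ ^ 2 ≤ 62 / 25) : 4 / 9 ≤ besselCross s₁ s₂ := by
  have hz1 : (s₁ / 2) ^ 2 ≤ 3 / 100 := by linarith [div_pow s₁ 2 2]
  have hz2 : 3 / 5 ≤ (s₂ / 2) ^ 2 := by linarith [div_pow s₂ 2 2]
  have hz2' : (s₂ / 2) ^ 2 ≤ 62 / 100 := by linarith [div_pow s₂ 2 2]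
  have hJ1 := powSum_coeffJ_bounds (sq_nonneg (s₁ / 2)) (by linarith)
  have hJ2 := powSum_coeffJ_bounds (sq_nonneg (s₂ / 2)) (by linarith)
  have hS1 := powSum_coeffS_bounds (sq_nonneg (s₁ / 2)) (by linarith)
  have hS2 := powSum_coeffS_bounds (sq_nonneg (s₂ / 2)) (by linarith)
  rw [← besselJ0_eq] at hJ1 hJ2
  change _ ≤ serS s₁ ∧ _ at hS1
  change _ ∧ serS s₂ ≤ _ at hS2
  have hlog : 1 ≤ Real.log (s₂ / s₁) := by
    rw [Real.le_log_iff_exp_le (by positivity), le_div_iff₀ h1]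
    have h3 : 3 * s₁ ≤ s₂ := abs_le_of_sq_le_sq' (by nlinarith) h2.le |>.2
    nlinarith [Real.exp_one_lt_d9]
  have hS2' : 465 / 1000 ≤ -serS s₂ := by nlinarith
  have t1 : 36 / 100 ≤ besselJ0 s₁ * besselJ0 s₂ := by nlinarith
  have t2 : 36 / 100 ≤ besselJ0 s₁ * besselJ0 s₂ * Real.log (s₂ / s₁) := by nlinarith
  have t3 : 45 / 100 ≤ besselJ0 s₁ * -serS s₂ := by nlinarith
  have t4 : -(3 / 100) ≤ besselJ0 s₂ * serS s₁ := by nlinarith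
  have hπ' : 636 / 1000 ≤ 2 / π := by
    rw [le_div_iff₀ pi_pos]
    linarith [pi_lt_d4]
  rw [besselCross_eq h1 h2]
  nlinarith

/-! ### Geometry of the arcs -/

lemma dist_polarPt_sq (R θ r φ : ℝ) :
    dist (polarPt R θ) (polarPt r φ) ^ 2 = R ^ 2 + r ^ 2 - 2 * R * r * cos (θ - φ) := by
  rw [EuclideanSpace.dist_eq, Real.sq_sqrt (by positivity), Fin.sum_univ_two]
  simp only [polarPt, Real.dist_eq, sq_abs, cos_sub]
  simp
  linear_combination R ^ 2 * sin_sq_add_cos_sq θ + r ^ 2 * sin_sq_add_cos_sq φ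

/-- The squared Bessel arguments by the law of cosines; as `m ≥ 10`, a point of the arc is seen
from the centre at an angle of at most `π / 10` to the axis that carries the reference points. -/
lemma exists_arg_sq_eq {a τ k : ℝ} {m : ℕ} (hm : 10 ≤ m) {j : ℕ}
    {x : EuclideanSpace ℝ (Fin 2)} (hx : x ∈ arc (radius a τ k) m j) :
    ∃ c : ℝ, 95 / 100 ≤ c ∧ c ≤ 1 ∧ ∀ l, arg a τ k m j x l ^ 2 =
      (k * radius a τ k) ^ 2 * (1 + lam a τ k l ^ 2 - 2 * lam a τ k l * c) := by
  obtain ⟨θ, h1, h2, rfl⟩ := hx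
  refine ⟨cos (θ - nu m (2 * j - 1)), ?_, cos_le_one _, fun l => ?_⟩
  · have hm' : (10 : ℝ) ≤ m := by exact_mod_cast hm
    have hle : π / m ≤ π / 10 := by gcongr
    have e1 : nu m (2 * j - 2) = nu m (2 * j - 1) - π / m := by simp only [nu]; ring
    have e2 : nu m (2 * j) = nu m (2 * j - 1) + π / m := by simp only [nu]; ring
    have hπ := pi_lt_d4
    have hcos := one_sub_sq_div_two_le_cos (x := θ - nu m (2 * j - 1))
    have hsq : (θ - nu m (2 * j - 1)) ^ 2 ≤ (π / 10) ^ 2 :=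
      sq_le_sq' (by linarith) (by linarith)
    nlinarith [pi_pos]
  · rw [arg, mul_pow, refPt, dist_polarPt_sq]
    ring

lemma arg_nonneg {a τ k : ℝ} (hk : 0 ≤ k) (m j : ℕ) (x : EuclideanSpace ℝ (Fin 2)) (l : Fin 2) :
    0 ≤ arg a τ k m j x l := mul_nonneg hk dist_nonneg

lemma det_matA (a τ k : ℝ) (m j : ℕ) (x : EuclideanSpace ℝ (Fin 2)) :
    (matA a τ k m j x).det = besselCross (arg a τ k m j x 0) (arg a τ k m j x 1) := by
  simp only [matA, Matrix.det_fin_two_of, besselCross]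
  ring

lemma det_matD (a τ k : ℝ) (m j : ℕ) (x : EuclideanSpace ℝ (Fin 2)) :
    (matD a τ k m j x).det = (matA a τ k m j x).det ^ 3 := by
  simp only [matD, matA, Matrix.det_fin_two_of, Matrix.det_fin_three]
  simp
  ring

/-- A point of the arc has distances `s₁`, `s₂`, scaled by the wavenumber, to reference points
`π / 2` apart on the axis; `K` is the scaled radius, `K / 2` and `K L` the scaled distances of the
reference points from the centre, and `c` the cosine of the angle to the axis. -/
lemma abs_besselCross_ge_of_far {K L c s₁ s₂ : ℝ} (hK : 6 * π ≤ K) (hL : K * L = K / 2 + π / 2)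
    (hc : 95 / 100 ≤ c) (hc1 : c ≤ 1) (h1 : 0 ≤ s₁) (h2 : 0 ≤ s₂)
    (e1 : s₁ ^ 2 = K ^ 2 * (1 + (1 / 2) ^ 2 - 2 * (1 / 2) * c))
    (e2 : s₂ ^ 2 = K ^ 2 * (1 + L ^ 2 - 2 * L * c)) :
    1 / K ≤ |besselCross s₁ s₂| := by
  have hπ := pi_gt_d2
  have hK0 : 0 < K := by linarith
  have e2' : s₂ ^ 2 = K ^ 2 + (K / 2 + π / 2) ^ 2 - 2 * K * (K / 2 + π / 2) * c := by
    rw [← hL, e2]; ring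
  have hdiff : s₁ ^ 2 - s₂ ^ 2 = K * π * (c - 1 / 2) - π ^ 2 / 4 := by
    rw [e1, e2']; ring
  -- `0.5478` is an upper approximation of `√(5 / 4 - 0.95)`
  have hs1 : s₁ ≤ 5478 / 10000 * K := by
    refine abs_le_of_sq_le_sq' ?_ (by positivity) |>.2
    nlinarith [sq_nonneg K]
  have hs2 : K / 2 - π / 2 ≤ s₂ := by
    refine abs_le_of_sq_le_sq' ?_ h2 |>.2
    rw [e2']
    nlinarith [mul_nonneg (mul_nonneg hK0.le (by positivity : 0 ≤ K / 2 + π / 2))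
      (sub_nonneg.2 hc1)]
  -- the projection of the segment of length `s₂` to the axis has length `K c - K L`
  have hs2' : K * (c - 1 / 2) - π / 2 ≤ s₂ := by
    refine abs_le_of_sq_le_sq' ?_ h2 |>.2
    rw [e2']
    nlinarith [mul_nonneg (sq_nonneg K) (mul_nonneg (by linarith : 0 ≤ 1 + c) (sub_nonneg.2 hc1))]
  have hupper : s₁ - s₂ ≤ π / 2 := by
    have : s₁ ≤ s₂ + π / 2 := by
      refine abs_le_of_sq_le_sq' ?_ (by positivity) |>.2
      nlinarith [mul_le_mul_of_nonneg_left hs2' pi_pos.le]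
    linarith
  -- `0.4083` is just below `0.95 - 1 / 2 - π / (4 K)` at `K = 6 π`
  have hprod : 4083 / 10000 * (K * π) ≤ (s₁ - s₂) * (s₁ + s₂) := by
    have : (s₁ - s₂) * (s₁ + s₂) = K * π * (c - 1 / 2) - π ^ 2 / 4 := by rw [← hdiff]; ring
    nlinarith [mul_nonneg (mul_pos hK0 pi_pos).le (sub_nonneg.2 hc),
      mul_le_mul_of_nonneg_left hK pi_pos.le]
  have hsum : 0 < s₁ + s₂ := by
    linarith
  have hpos : 0 < s₁ - s₂ := by
    have h : 0 < (s₁ - s₂) * (s₁ + s₂) := lt_of_lt_of_le (by positivity) hprod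
    exact (pos_iff_pos_of_mul_pos h).2 hsum
  have hlower : 117 / 100 ≤ s₁ - s₂ := by
    by_contra hlt
    push Not at hlt
    have h3 : (s₁ - s₂) * (s₁ + s₂) ≤ 117 / 100 * (10956 / 10000 * K) :=
      mul_le_mul hlt.le (by linarith) hsum.le (by norm_num)
    nlinarith
  have h := abs_besselCross_ge_of_large (by linarith) hlower hupper
  refine le_trans ?_ h
  rw [div_le_div_iff₀ hK0 (by linarith)]
  linarith

lemma existsUnique_mulVec_eq {n : Type*} [Fintype n] [DecidableEq n] {M : Matrix n n ℝ}
    (hM : M.det ≠ 0) (f : n → ℝ) : ∃! e : n → ℝ, M.mulVec e = f := by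
  have hu : IsUnit M := (Matrix.isUnit_iff_isUnit_det M).2 hM.isUnit
  refine ⟨M⁻¹.mulVec f, ?_, fun e he => Matrix.mulVec_injective_of_isUnit hu ?_⟩
  · simp [Matrix.mulVec_mulVec, Matrix.mul_nonsing_inv M hM.isUnit]
  · simp [he, Matrix.mulVec_mulVec, Matrix.mul_nonsing_inv M hM.isUnit]

/-! ### Lower bounds for the determinant -/

lemma abs_det_matA_ge {a τ : ℝ} (ha : 0 < a) (hτ : 6 ≤ τ) {m : ℕ} (hm : 10 ≤ m) {k : ℝ}
    (hk : k ∈ admissible a) (hne : k ≠ kStar a) {j : ℕ} {x : EuclideanSpace ℝ (Fin 2)}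
    (hx : x ∈ arc (radius a τ k) m j) :
    (20 * τ - 7) / (20 * τ) / (k * radius a τ k) ≤ |(matA a τ k m j x).det| := by
  obtain ⟨y, hy, rfl⟩ : ∃ y : ℝ, 1 ≤ y ∧ k = π / a * y := hk.resolve_right hne
  set k := π / a * y
  have hk0 : 0 < k := by positivity
  have hR : radius a τ k = τ * a := if_neg hne
  have hK : 6 * π ≤ k * radius a τ k := by
    have e : k * radius a τ k = π * (y * τ) := by
      rw [hR]; simp only [k]; field_simp
    rw [e]
    nlinarith [pi_pos, mul_le_mul hy hτ (by norm_num) (by linarith)]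
  have hK0 : 0 < k * radius a τ k := by linarith [pi_pos]
  have hR0 : 0 < radius a τ k := by rw [hR]; positivity
  have hl1 : lam a τ k 1 = 1 / 2 + π / (2 * k * radius a τ k) := by
    simp [lam, hne]
  obtain ⟨c, hc, hc1, hs⟩ := exists_arg_sq_eq hm hx
  rw [det_matA]
  have h := abs_besselCross_ge_of_far (L := lam a τ k 1) hK
    (by rw [hl1]; field_simp) hc hc1 (arg_nonneg hk0.le m j x 0) (arg_nonneg hk0.le m j x 1)
    (hs 0) (hs 1)
  refine le_trans ?_ h
  gcongr
  rw [div_le_one (by positivity)]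
  linarith

lemma abs_det_matA_kStar_ge {a : ℝ} (ha : 0 < a) (τ : ℝ) {m : ℕ} (hm : 10 ≤ m) {j : ℕ}
    {x : EuclideanSpace ℝ (Fin 2)} (hx : x ∈ arc (radius a τ (kStar a)) m j) :
    4 / 9 ≤ |(matA a τ (kStar a) m j x).det| := by
  have hk0 : 0 < kStar a := by rw [kStar]; positivity
  have hK : kStar a * radius a τ (kStar a) = π / 5 := by
    rw [radius, if_pos rfl, kStar]
    field_simp
    norm_num
  obtain ⟨c, hc, hc1, hs⟩ := exists_arg_sq_eq hm hx
  have e0 := hs 0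
  have e1 := hs 1
  have hl0 : lam a τ (kStar a) 0 = 1 / 2 := rfl
  have hl1 : lam a τ (kStar a) 1 = -(3 / 2) := by simp [lam]
  rw [hK, hl0] at e0
  rw [hK, hl1] at e1
  have hπ := pi_gt_d4
  have hπ' := pi_lt_d4
  have hsq : 394 / 1000 ≤ (π / 5) ^ 2 := by nlinarith
  have hsq' : (π / 5) ^ 2 ≤ 395 / 1000 := by nlinarith
  have pos : ∀ l, 0 < arg a τ (kStar a) m j x l ^ 2 → 0 < arg a τ (kStar a) m j x l :=
    fun l h => (arg_nonneg hk0.le m j x l).lt_of_ne' (by rintro h0; simp [h0] at h)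
  rw [det_matA]
  refine le_trans (besselCross_ge_of_small (pos 0 ?_) ?_ (pos 1 ?_) ?_ ?_) (le_abs_self _)
  all_goals first | rw [e0] | rw [e1]
  all_goals nlinarith

end PhaseRetrieval

theorem theorem2p1 (a τ : ℝ) (ha : 0 < a) (hτ : 6 ≤ τ) (m : ℕ) (hm : 10 ≤ m)
    (k : ℝ) (hk : k ∈ PhaseRetrieval.admissible a)
    (j : ℕ) (hj1 : 1 ≤ j) (hjm : j ≤ m)
    (x : EuclideanSpace ℝ (Fin 2))
    (hx : x ∈ PhaseRetrieval.arc (PhaseRetrieval.radius a τ k) m j) :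
    (k ≠ PhaseRetrieval.kStar a →
      (20 * τ - 7) / (20 * τ) / (k * PhaseRetrieval.radius a τ k)
        ≤ |(PhaseRetrieval.matA a τ k m j x).det|) ∧
    (k = PhaseRetrieval.kStar a → 4 / 9 ≤ |(PhaseRetrieval.matA a τ k m j x).det|) ∧
    (PhaseRetrieval.matD a τ k m j x).det = (PhaseRetrieval.matA a τ k m j x).det ^ 3 ∧
    (k ≠ PhaseRetrieval.kStar a →
      ((20 * τ - 7) / (20 * τ) / (k * PhaseRetrieval.radius a τ k)) ^ 3
        ≤ |(PhaseRetrieval.matD a τ k m j x).det|) ∧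
    (k = PhaseRetrieval.kStar a →
      (4 / 9) ^ 3 ≤ |(PhaseRetrieval.matD a τ k m j x).det|) ∧
    (∀ f : Fin 2 → ℝ, ∃! e : Fin 2 → ℝ, (PhaseRetrieval.matA a τ k m j x).mulVec e = f) ∧
    (∀ F : Fin 3 → ℝ, ∃! v : Fin 3 → ℝ, (PhaseRetrieval.matD a τ k m j x).mulVec v = F) := by
  have hA (h : k ≠ PhaseRetrieval.kStar a) :=
    PhaseRetrieval.abs_det_matA_ge ha hτ hm hk h hx
  have hA' (h : k = PhaseRetrieval.kStar a) :
      4 / 9 ≤ |(PhaseRetrieval.matA a τ k m j x).det| := by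
    subst h
    exact PhaseRetrieval.abs_det_matA_kStar_ge ha τ hm hx
  have hD := PhaseRetrieval.det_matD a τ k m j x
  have hM (h : k ≠ PhaseRetrieval.kStar a) :
      0 < (20 * τ - 7) / (20 * τ) / (k * PhaseRetrieval.radius a τ k) := by
    obtain ⟨y, hy, hky⟩ : ∃ y : ℝ, 1 ≤ y ∧ k = π / a * y := hk.resolve_right h
    have hk0 : 0 < k := by rw [hky]; positivity
    rw [PhaseRetrieval.radius, if_neg h]
    exact div_pos (div_pos (by linarith) (by linarith)) (by positivity)
  have hne : (PhaseRetrieval.matA a τ k m j x).det ≠ 0 := by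
    rw [← abs_pos]
    by_cases h : k = PhaseRetrieval.kStar a
    · exact lt_of_lt_of_le (by norm_num) (hA' h)
    · exact (hM h).trans_le (hA h)
  refine ⟨hA, hA', hD, fun h => ?_, fun h => ?_, PhaseRetrieval.existsUnique_mulVec_eq hne,
    PhaseRetrieval.existsUnique_mulVec_eq (by rw [hD]; exact pow_ne_zero 3 hne)⟩
  · rw [hD, abs_pow]
    exact pow_le_pow_left₀ (hM h).le (hA h) 3
  · rw [hD, abs_pow]
    exact pow_le_pow_left₀ (by norm_num) (hA' h) 3
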